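/- Call a topological space almost discrete if it has precisely one nonisolated point. For a Tychonoff space $X$, let $C_p(X)$ be the space of continuous functions $X\to\mathbb{R}$ with the topology of pointwise convergence. A subset $A$ of a space $Z$ is countably compact in $Z$ if each sequence of points of $A$ has a cluster point in $Z$; $Z$ is a $g$-space if every $A\subseteq Z$ that is countably compact in $Z$ has compact closure in $Z$; and $X$ is a Grothendieck space if $C_p(X)$ is a hereditary $g$-space, i.e. every subspace of $C_p(X)$ is a $g$-space. The tightness $t(X)$ is the least infinite cardinal $\tau$ such that whenever $A\subseteq X$ and $x\in\overline{A}$, there is $B\subseteq A$ with $|B|\le\tau$ and $x\in\overline{B}$. Theorem. Let $X=\prod_{i\in I}X_i$ be a product of countably many almost discrete Tychonoff spaces $X_i$. Then $X$ is a Grothendieck space if and only if $t(X)=\omega$ and $X$ is Lindelöf. The same equivalence holds if, in the definition of a $g$-space, "countably compact in $Z$" is replaced by "countably compact" (i.e. each sequence of points of $A$ has a cluster point in $A$). -/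

import Mathlib

universe u

/-- `X` has precisely one nonisolated point. -/
def IsAlmostDiscrete (X : Type u) [TopologicalSpace X] : Prop :=
  ∃! x : X, ¬ IsOpen ({x} : Set X)

/-- `C_p(X)`: the continuous real-valued functions on `X` with the topology of pointwise
convergence, that is, the subspace topology inherited from the product `X → ℝ`. -/
abbrev Cp (X : Type u) [TopologicalSpace X] : Type u :=
  {f : X → ℝ // Continuous f}

/-- `A` is countably compact in `Z`: each sequence of points of `A` has a limit (cluster) point
in the ambient space `Z`. -/
def IsCountablyCompactIn {Z : Type u} [TopologicalSpace Z] (A : Set Z) : Prop :=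
  ∀ s : ℕ → Z, (∀ n, s n ∈ A) → ∃ z : Z, MapClusterPt z Filter.atTop s

/-- `Z` is a g-space: each subset that is countably compact in `Z` has compact closure in `Z`. -/
def IsGSpace (Z : Type u) [TopologicalSpace Z] : Prop :=
  ∀ A : Set Z, IsCountablyCompactIn A → IsCompact (closure A)

/-- The variant of g-spaces in which only the subsets that are countably compact in themselves
are tested. -/
def IsCCGSpace (Z : Type u) [TopologicalSpace Z] : Prop :=
  ∀ A : Set Z, IsCountablyCompact A → IsCompact (closure A)

/-- `X` is a Grothendieck space: every subspace of `C_p(X)` is a g-space. -/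
def IsGrothendieckSpace (X : Type u) [TopologicalSpace X] : Prop :=
  ∀ Y : Set (Cp X), IsGSpace Y

/-- The variant of Grothendieck spaces that belongs to `IsCCGSpace`. -/
def IsCCGrothendieckSpace (X : Type u) [TopologicalSpace X] : Prop :=
  ∀ Y : Set (Cp X), IsCCGSpace Y

/-- The tightness of `X`: the least infinite cardinal `τ` such that every point of the closure
of a set `A` is in the closure of some subset of `A` of cardinality at most `τ`. -/
noncomputable def tightness (X : Type u) [TopologicalSpace X] : Cardinal.{u} :=
  sInf {τ : Cardinal.{u} | Cardinal.aleph0 ≤ τ ∧ ∀ (A : Set X), ∀ x ∈ closure A,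
    ∃ B : Set X, B ⊆ A ∧ Cardinal.mk B ≤ τ ∧ x ∈ closure B}

open Set Filter Topology

/-! Let `p i` be the nonisolated point of `X i`. Both equivalences follow from one cycle:
Grothendieck ⇒ its countably compact variant ⇒ countably tight and Lindelöf ⇒ Grothendieck.

Sufficiency: in a Lindelöf factor the neighbourhoods of `p i` are cocountable, so a continuous
function on the product is determined by countably many coordinate values
(`exists_countable_comp_coordRetract`). Let `A` be countably compact in `Y`. Tightness makes every
function in the closure of `A` in `ℝ^X` continuous; each is then the only possible continuous
cluster point of some sequence in `A` (`exists_seq_unique_mapClusterPt`), so it lies in `Y`.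
Pointwise boundedness gives compactness.

Necessity: if `φ` maps onto an uncountable set whose countable subsets have clopen preimages, the
indicators of these preimages are countably compact but not compact
(`not_isCCGrothendieckSpace_of_isClopen_preimage`). Such a set arises from a neighbourhood of `p i`
with uncountable complement, and from a minimal finite set of coordinates on which countable
tightness fails. -/

theorem countable_finset_coe_subset {E : Type*} {D : Set E} (hD : D.Countable) :
    {F : Finset E | (F : Set E) ⊆ D}.Countable := by
  refine ((Set.countable_ofPred_finite_subset hD).preimage_of_injOn
    (f := fun F : Finset E => (F : Set E)) Finset.coe_injective.injOn).mono ?_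
  intro F hF
  simp only [mem_preimage, mem_ofPred_eq] at hF ⊢
  exact ⟨F.finite_toSet, hF⟩

/-- A countable set can be enlarged to a countable set closed under a countable-set-valued
operation on finite sets. -/
theorem exists_countable_closed_under {E : Type*} (Ψ : Finset E → Set E)
    (hΨ : ∀ F, (Ψ F).Countable) {D₀ : Set E} (hD₀ : D₀.Countable) :
    ∃ D : Set E, D.Countable ∧ D₀ ⊆ D ∧ ∀ F : Finset E, (F : Set E) ⊆ D → Ψ F ⊆ D := by
  let step : Set E → Set E := fun D => D ∪ ⋃ F ∈ {F : Finset E | (F : Set E) ⊆ D}, Ψ F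
  let D : ℕ → Set E := fun n => step^[n] D₀
  have hsucc : ∀ n, D (n + 1) = step (D n) := fun n => Function.iterate_succ_apply' _ _ _
  have hmono : Monotone D := monotone_nat_of_le_succ fun n => by
    rw [hsucc]; exact subset_union_left
  have hcount : ∀ n, (D n).Countable := by
    intro n
    induction n with
    | zero => exact hD₀
    | succ n ih =>
      rw [hsucc]
      exact ih.union (Set.Countable.biUnion (countable_finset_coe_subset ih) fun F _ => hΨ F)
  refine ⟨⋃ n, D n, countable_iUnion hcount, subset_iUnion D 0, fun F hF => ?_⟩
  obtain ⟨n, hn⟩ := hmono.directed_le.exists_mem_subset_of_finset_subset_biUnion hF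
  refine Subset.trans ?_ (subset_iUnion D (n + 1))
  rw [hsucc]
  exact subset_union_of_subset_right (subset_biUnion_of_mem (u := Ψ) hn) _

/-! ### Retractions onto countably many coordinate values -/

section Retraction

variable {ι : Type*} {X : ι → Type*}

open Classical in
/-- The retraction of a product that replaces the coordinates outside `D` by those of `p`. -/
noncomputable def coordRetract (p : ∀ i, X i) (D : Set (Σ i, X i)) (x : ∀ i, X i) : ∀ i, X i :=
  fun i => if (⟨i, x i⟩ : Σ i, X i) ∈ D then x i else p i

open Classical in
/-- The point with the coordinates listed in `F`, all others being those of `p`. -/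
noncomputable def finsetPoint (p : ∀ i, X i) (F : Finset (Σ i, X i)) : ∀ i, X i :=
  fun i => if h : ∃ d, (⟨i, d⟩ : Σ i, X i) ∈ F then h.choose else p i

theorem coordRetract_apply_of_mem (p : ∀ i, X i) {D : Set (Σ i, X i)} {x : ∀ i, X i} {i : ι}
    (h : (⟨i, x i⟩ : Σ i, X i) ∈ D) : coordRetract p D x i = x i :=
  if_pos h

theorem coordRetract_apply_of_notMem (p : ∀ i, X i) {D : Set (Σ i, X i)} {x : ∀ i, X i} {i : ι}
    (h : (⟨i, x i⟩ : Σ i, X i) ∉ D) : coordRetract p D x i = p i :=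
  if_neg h

theorem coordRetract_congr (p : ∀ i, X i) (D : Set (Σ i, X i)) {x y : ∀ i, X i} {i : ι}
    (h : x i = y i) : coordRetract p D x i = coordRetract p D y i := by
  by_cases hD : (⟨i, x i⟩ : Σ i, X i) ∈ D
  · rw [coordRetract_apply_of_mem p hD, coordRetract_apply_of_mem p (h ▸ hD), h]
  · rw [coordRetract_apply_of_notMem p hD, coordRetract_apply_of_notMem p (h ▸ hD)]

theorem coordRetract_apply_of_eq (p : ∀ i, X i) (D : Set (Σ i, X i)) {x : ∀ i, X i} {i : ι}
    (h : x i = p i) : coordRetract p D x i = p i := by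
  by_cases hD : (⟨i, x i⟩ : Σ i, X i) ∈ D
  · rw [coordRetract_apply_of_mem p hD, h]
  · exact coordRetract_apply_of_notMem p hD

theorem coordRetract_comp_of_subset (p : ∀ i, X i) {D D' : Set (Σ i, X i)} (h : D ⊆ D')
    (x : ∀ i, X i) : coordRetract p D (coordRetract p D' x) = coordRetract p D x := by
  funext i
  by_cases h' : (⟨i, x i⟩ : Σ i, X i) ∈ D'
  · exact coordRetract_congr p D (coordRetract_apply_of_mem p h')
  · rw [coordRetract_apply_of_eq p D (coordRetract_apply_of_notMem p h'),
      coordRetract_apply_of_notMem p fun hh => h' (h hh)]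

/-- Finitely many coordinates of a retracted point can be realized by a `finsetPoint`. -/
theorem exists_finsetPoint_eqOn (p : ∀ i, X i) (D : Set (Σ i, X i)) (x : ∀ i, X i)
    (S : Finset ι) : ∃ F : Finset (Σ i, X i), (F : Set (Σ i, X i)) ⊆ D ∧
      ∀ i ∈ S, finsetPoint p F i = coordRetract p D x i := by
  classical
  refine ⟨(S.image fun i => (⟨i, x i⟩ : Σ i, X i)).filter (· ∈ D), ?_, ?_⟩
  · intro e he
    simp only [Finset.coe_filter, mem_ofPred_eq] at he
    exact he.2
  · intro i hi
    by_cases hD : (⟨i, x i⟩ : Σ i, X i) ∈ D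
    · have hex : ∃ d, (⟨i, d⟩ : Σ i, X i) ∈
          (S.image fun i => (⟨i, x i⟩ : Σ i, X i)).filter (· ∈ D) :=
        ⟨x i, by simp only [Finset.mem_filter, Finset.mem_image]; exact ⟨⟨i, hi, rfl⟩, hD⟩⟩
      obtain ⟨j, -, hj⟩ := Finset.mem_image.1 (Finset.mem_filter.1 hex.choose_spec).1
      have hl : finsetPoint p _ i = hex.choose := dif_pos hex
      rw [hl, coordRetract_apply_of_mem p hD]
      generalize hex.choose = d at hj
      obtain ⟨rfl, hj⟩ := Sigma.mk.inj_iff.1 hj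
      exact (eq_of_heq hj).symm
    · have hex : ¬ ∃ d, (⟨i, d⟩ : Σ i, X i) ∈
          (S.image fun i => (⟨i, x i⟩ : Σ i, X i)).filter (· ∈ D) := by
        rintro ⟨d, hd⟩
        simp only [Finset.mem_filter, Finset.mem_image] at hd
        obtain ⟨⟨j, -, hj⟩, hd⟩ := hd
        rw [← hj] at hd
        obtain ⟨rfl, -⟩ := Sigma.mk.inj_iff.1 hj
        exact hD hd
      exact (dif_neg hex).trans (coordRetract_apply_of_notMem p hD).symm

variable [∀ i, TopologicalSpace (X i)]

theorem coordRetract_mem_closure (p : ∀ i, X i) (D : Set (Σ i, X i)) (x : ∀ i, X i) :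
    coordRetract p D x ∈ closure (finsetPoint p '' {F | (F : Set (Σ i, X i)) ⊆ D}) := by
  rw [mem_closure_iff]
  intro o ho hx
  obtain ⟨I, u, hu, hI⟩ := isOpen_pi_iff.1 ho _ hx
  obtain ⟨F, hF, hFI⟩ := exists_finsetPoint_eqOn p D x I
  refine ⟨finsetPoint p F, hI fun i hi => ?_, F, hF, rfl⟩
  rw [hFI i hi]
  exact (hu i hi).2

/-- Every open cover of a countable product of spaces in which the neighbourhoods of `p i` are
cocountable is determined by countably many coordinate values: some member of the cover
contains both `x` and its retraction. -/
theorem exists_countable_coordRetract_cover [Countable ι] (p : ∀ i, X i)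
    (hc : ∀ i, ∀ W ∈ 𝓝 (p i), (Wᶜ : Set (X i)).Countable)
    {κ : Type*} (U : κ → Set (∀ i, X i)) (hUo : ∀ a, IsOpen (U a)) (hU : ∀ x, ∃ a, x ∈ U a) :
    ∃ (D : Set (Σ i, X i)) (V : Finset (Σ i, X i) → κ), D.Countable ∧
      ∀ x, ∃ F : Finset (Σ i, X i), (F : Set (Σ i, X i)) ⊆ D ∧ x ∈ U (V F) ∧
        coordRetract p D x ∈ U (V F) := by
  classical
  obtain ⟨e, he⟩ := exists_injective_nat ι
  -- `P q k`: some member of the cover contains a neighbourhood of `q` restricting only the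
  -- coordinates numbered below `k`. The least such `k` is used below.
  let P : (∀ i, X i) → ℕ → Prop := fun q k => ∃ (a : κ) (W : ∀ i, Set (X i)),
    (∀ i, W i ∈ 𝓝 (q i)) ∧ {x | ∀ i, e i < k → x i ∈ W i} ⊆ U a
  have hP : ∀ q, ∃ k, P q k := by
    intro q
    obtain ⟨a, ha⟩ := hU q
    obtain ⟨I, u, hu, hI⟩ := isOpen_pi_iff.1 (hUo a) _ ha
    refine ⟨I.sup e + 1, a, fun i => if i ∈ I then u i else univ, fun i => ?_, fun x hx => ?_⟩
    · dsimp only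
      split_ifs with hi
      · exact (hu i hi).1.mem_nhds (hu i hi).2
      · exact univ_mem
    · refine hI fun i hi => ?_
      rw [mem_ofPred_eq] at hx
      have := hx i (Nat.lt_succ_of_le (Finset.le_sup (f := e) hi))
      dsimp only at this
      rwa [if_pos (Finset.mem_coe.1 hi)] at this
  let k : (∀ i, X i) → ℕ := fun q => Nat.find (hP q)
  have hk : ∀ q, P q (k q) := fun q => Nat.find_spec (hP q)
  choose a W hW hWU using hk
  -- Closing `D` under `Ψ` forces every value that is retracted to `p i` to lie already in the
  -- chosen neighbourhood of `p i`.
  let Ψ : Finset (Σ i, X i) → Set (Σ i, X i) := fun F =>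
    ⋃ i, if finsetPoint p F i = p i then Sigma.mk i '' (W (finsetPoint p F) i)ᶜ else ∅
  have hΨ : ∀ F, (Ψ F).Countable := by
    intro F
    refine countable_iUnion fun i => ?_
    split_ifs with h
    · refine (hc i _ ?_).image _
      rw [← h]; exact hW _ _
    · exact countable_empty
  obtain ⟨D, hD, -, hDc⟩ := exists_countable_closed_under Ψ hΨ countable_empty
  refine ⟨D, fun F => a (finsetPoint p F), hD, fun x => ?_⟩
  set y := coordRetract p D x with hy
  have hfin : {i | e i < k y}.Finite := (finite_lt_nat (k y)).preimage he.injOn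
  obtain ⟨F, hF, hFy⟩ := exists_finsetPoint_eqOn p D x hfin.toFinset
  have hFy' : ∀ i, e i < k y → finsetPoint p F i = y i := fun i hi =>
    hFy i (hfin.mem_toFinset.2 hi)
  -- The neighbourhood chosen for `y` also serves the approximating point, so by minimality of `k`
  -- the two agree on all coordinates that the latter's own neighbourhood restricts.
  have hkF : k (finsetPoint p F) ≤ k y := by
    refine Nat.find_min' (hP _) ⟨a y, fun i => if e i < k y then W y i else univ, fun i => ?_, ?_⟩
    · dsimp only
      split_ifs with hi
      · rw [hFy' i hi]; exact hW y i
      · exact univ_mem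
    · intro z hz
      refine hWU y fun i hi => ?_
      rw [mem_ofPred_eq] at hz
      have := hz i hi
      dsimp only at this
      rwa [if_pos hi] at this
  have key : ∀ i, e i < k (finsetPoint p F) → x i ∈ W (finsetPoint p F) i ∧
      y i ∈ W (finsetPoint p F) i := by
    intro i hi
    have hq := hFy' i (hi.trans_le hkF)
    have hyW : y i ∈ W (finsetPoint p F) i := by
      rw [← hq]; exact mem_of_mem_nhds (hW _ _)
    refine ⟨?_, hyW⟩
    by_cases hxD : (⟨i, x i⟩ : Σ i, X i) ∈ D
    · have : y i = x i := if_pos hxD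
      rwa [← this]
    · have hyp : y i = p i := if_neg hxD
      by_contra hxW
      refine hxD (hDc F hF (mem_iUnion.2 ⟨i, ?_⟩))
      rw [if_pos (hq.trans hyp)]
      exact ⟨x i, hxW, rfl⟩
  exact ⟨F, hF, hWU _ fun i hi => (key i hi).1, hWU _ fun i hi => (key i hi).2⟩

/-- A countable product of spaces in which the neighbourhoods of some point are cocountable is
Lindelöf. -/
theorem lindelofSpace_pi_of_cocountable_nhds [Countable ι] (p : ∀ i, X i)
    (hc : ∀ i, ∀ W ∈ 𝓝 (p i), (Wᶜ : Set (X i)).Countable) : LindelofSpace (∀ i, X i) := by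
  refine isLindelof_univ_iff.1 (isLindelof_of_countable_subcover fun {κ} U hUo hU => ?_)
  obtain ⟨D, V, hD, h⟩ := exists_countable_coordRetract_cover p hc U hUo
    fun x => mem_iUnion.1 (hU (mem_univ x))
  refine ⟨V '' {F | (F : Set (Σ i, X i)) ⊆ D}, (countable_finset_coe_subset hD).image V,
    fun x _ => ?_⟩
  obtain ⟨F, hF, hx, -⟩ := h x
  exact mem_biUnion (mem_image_of_mem V hF) hx

/-- A continuous real function on a countable product of spaces in which the neighbourhoods of
`p i` are cocountable factors through the retraction onto countably many coordinate values. -/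
theorem exists_countable_comp_coordRetract [Countable ι] (p : ∀ i, X i)
    (hc : ∀ i, ∀ W ∈ 𝓝 (p i), (Wᶜ : Set (X i)).Countable)
    {f : (∀ i, X i) → ℝ} (hf : Continuous f) :
    ∃ D : Set (Σ i, X i), D.Countable ∧
      ∀ D', D ⊆ D' → ∀ x, f (coordRetract p D' x) = f x := by
  have h : ∀ n : ℕ, ∃ D : Set (Σ i, X i), D.Countable ∧
      ∀ x, dist (f (coordRetract p D x)) (f x) < 2 / ((n : ℝ) + 1) := by
    intro n
    have hpos : 0 < 1 / ((n : ℝ) + 1) := Nat.one_div_pos_of_nat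
    obtain ⟨D, V, hD, h⟩ := exists_countable_coordRetract_cover p hc
      (fun r : ℝ => f ⁻¹' Metric.ball r (1 / ((n : ℝ) + 1)))
      (fun r => Metric.isOpen_ball.preimage hf) (fun x => ⟨f x, Metric.mem_ball_self hpos⟩)
    refine ⟨D, hD, fun x => ?_⟩
    obtain ⟨F, -, hx, hy⟩ := h x
    have := dist_triangle_right (f (coordRetract p D x)) (f x) (V F)
    have h1 : dist (f x) (V F) < 1 / ((n : ℝ) + 1) := hx
    have h2 : dist (f (coordRetract p D x)) (V F) < 1 / ((n : ℝ) + 1) := hy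
    calc _ ≤ _ := this
      _ < 1 / ((n : ℝ) + 1) + 1 / ((n : ℝ) + 1) := add_lt_add h2 h1
      _ = _ := by ring
  choose D hD hfD using h
  refine ⟨⋃ n, D n, countable_iUnion hD, fun D' hD' x => ?_⟩
  refine eq_of_forall_dist_le fun ε hε => ?_
  obtain ⟨n, hn⟩ := exists_nat_one_div_lt (show 0 < ε / 4 by positivity)
  have hsub : D n ⊆ D' := (subset_iUnion D n).trans hD'
  -- `x` and its `D'`-retraction have the same `D n`-retraction, so their values differ by less than
  -- `4 / (n + 1) < ε`.
  have h1 := hfD n (coordRetract p D' x)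
  have h2 := hfD n x
  rw [coordRetract_comp_of_subset p hsub] at h1
  have h3 := dist_triangle_left (f (coordRetract p D' x)) (f x) (f (coordRetract p (D n) x))
  have h4 : 2 / ((n : ℝ) + 1) = 2 * (1 / ((n : ℝ) + 1)) := by ring
  linarith

end Retraction

/-! ### Sequences in function spaces and the sufficiency direction -/

/-- A function that can be approximated on the finite subsets of a countable set by members of a
family is the pointwise limit on that set of a sequence from the family. -/
theorem exists_seq_tendsto_on_countable {T κ : Type*} {C : Set T} (hC : C.Countable) (B : Set κ)
    (φ : κ → T → ℝ) (g : T → ℝ)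
    (h : ∀ K : Finset T, (K : Set T) ⊆ C → ∀ ε > 0, ∃ b ∈ B, ∀ x ∈ K, dist (φ b x) (g x) < ε) :
    ∃ s : ℕ → κ, (∀ n, s n ∈ B) ∧ ∀ x ∈ C, Tendsto (fun n => φ (s n) x) atTop (𝓝 (g x)) := by
  obtain ⟨e, he⟩ := countable_iff_exists_injOn.1 hC
  have hfin : ∀ n, {x ∈ C | e x < n}.Finite := fun n =>
    Set.Finite.of_injOn (f := e) (t := Iio n) (fun x hx => hx.2)
      (he.mono fun x hx => hx.1) (finite_Iio n)
  have hex : ∀ n : ℕ, ∃ b ∈ B, ∀ x ∈ (hfin n).toFinset,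
      dist (φ b x) (g x) < 1 / ((n : ℝ) + 1) := fun n =>
    h _ (fun x hx => ((hfin n).mem_toFinset.1 hx).1) _ Nat.one_div_pos_of_nat
  choose s hs hsg using hex
  refine ⟨s, hs, fun x hx => tendsto_iff_dist_tendsto_zero.2 ?_⟩
  refine squeeze_zero' (Eventually.of_forall fun _ => dist_nonneg) ?_
    tendsto_one_div_add_atTop_nhds_zero_nat
  filter_upwards [eventually_gt_atTop (e x)] with n hn
  exact (hsg n x ((hfin n).mem_toFinset.2 ⟨hx, hn⟩)).le

theorem exists_dist_lt_of_mem_closure {T : Type*} {B : Set (T → ℝ)} {g : T → ℝ}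
    (hg : g ∈ closure B) (K : Finset T) {ε : ℝ} (hε : 0 < ε) :
    ∃ f ∈ B, ∀ x ∈ K, dist (f x) (g x) < ε := by
  have ho : IsOpen ((K : Set T).pi fun x => Metric.ball (g x) ε) :=
    isOpen_set_pi K.finite_toSet fun _ _ => Metric.isOpen_ball
  obtain ⟨f, hf, hfB⟩ := mem_closure_iff.1 hg _ ho fun x _ => Metric.mem_ball_self hε
  exact ⟨f, hfB, fun x hx => hf x hx⟩

theorem MapClusterPt.eq_of_tendsto {T κ : Type*} [TopologicalSpace T] [T2Space T] {l : Filter κ}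
    {u : κ → T} {a b : T} (ha : MapClusterPt a l u) (hb : Tendsto u l (𝓝 b)) : a = b := by
  by_contra hne
  obtain ⟨U, V, hU, hV, haU, hbV, hUV⟩ := t2_separation hne
  obtain ⟨k, hk⟩ := ((mapClusterPt_iff_frequently.1 ha U (hU.mem_nhds haU)).and_eventually
    (hb.eventually (hV.mem_nhds hbV))).exists
  exact hUV.notMem_of_mem_left hk.1 hk.2

/-- A function on a countably tight space that agrees on each countable set with a continuous
function is continuous. -/
theorem continuous_of_eqOn_countable {T : Type*} [TopologicalSpace T]
    (ht : ∀ (A : Set T), ∀ x ∈ closure A, ∃ B ⊆ A, B.Countable ∧ x ∈ closure B) {g : T → ℝ}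
    (hg : ∀ C : Set T, C.Countable → ∃ h : T → ℝ, Continuous h ∧ ∀ x ∈ C, h x = g x) :
    Continuous g := by
  rw [continuous_iff_image_closure_subset_closure_image]
  rintro A _ ⟨x, hx, rfl⟩
  obtain ⟨B, hBA, hB, hxB⟩ := ht A x hx
  obtain ⟨h, hc, hh⟩ := hg (insert x B) (hB.insert x)
  rw [← hh x (mem_insert x B)]
  refine closure_mono (image_mono hBA) ?_
  rw [← image_congr fun y hy => hh y (mem_insert_of_mem x hy)]
  exact image_closure_subset_closure_image hc (mem_image_of_mem h hxB)

/-- The retractions of a countable product onto countably many coordinate values turn points of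
the closure of a set of continuous functions into limits of sequences. -/
theorem exists_seq_unique_mapClusterPt {ι : Type*} [Countable ι] {X : ι → Type*}
    [∀ i, TopologicalSpace (X i)] (p : ∀ i, X i)
    (hc : ∀ i, ∀ W ∈ 𝓝 (p i), (Wᶜ : Set (X i)).Countable) {B : Set ((∀ i, X i) → ℝ)}
    (hB : ∀ f ∈ B, Continuous f) {g : (∀ i, X i) → ℝ} (hg : g ∈ closure B) (hgc : Continuous g) :
    ∃ s : ℕ → (∀ i, X i) → ℝ, (∀ n, s n ∈ B) ∧
      ∀ h, Continuous h → MapClusterPt h atTop s → h = g := by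
  classical
  have hD : ∀ f : {f : (∀ i, X i) → ℝ // Continuous f}, ∃ D : Set (Σ i, X i), D.Countable ∧
      ∀ D', D ⊆ D' → ∀ x, f.1 (coordRetract p D' x) = f.1 x :=
    fun f => exists_countable_comp_coordRetract p hc f.2
  choose D hDc hDf using hD
  have happ : ∀ (F : Finset (Σ i, X i)) (m : ℕ), ∃ f ∈ B,
      ∀ x ∈ F.powerset.image (finsetPoint p), dist (f x) (g x) < 1 / ((m : ℝ) + 1) :=
    fun F m => exists_dist_lt_of_mem_closure hg _ Nat.one_div_pos_of_nat
  choose a haB ha using happ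
  -- `E` supports `g` and all approximants of `g` at the finite points built from `E`; hence `g` can
  -- be approximated there by functions invariant under the retraction to `E`.
  obtain ⟨E, hE, hgE, hEc⟩ := exists_countable_closed_under
    (fun F => ⋃ m, D ⟨a F m, hB _ (haB F m)⟩) (fun F => countable_iUnion fun m => hDc _)
    (hDc ⟨g, hgc⟩)
  obtain ⟨s, hs, hsg⟩ := exists_seq_tendsto_on_countable
    ((countable_finset_coe_subset hE).image (finsetPoint p))
    {f ∈ B | ∀ x, f (coordRetract p E x) = f x} id g (by
      intro K hK ε hε
      obtain ⟨T, hT, rfl⟩ := Finset.subset_set_image_iff.1 hK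
      obtain ⟨m, hm⟩ := exists_nat_one_div_lt hε
      have hF : ((T.biUnion id : Finset (Σ i, X i)) : Set (Σ i, X i)) ⊆ E := by
        intro d hd
        obtain ⟨F, hFT, hdF⟩ := Finset.mem_biUnion.1 (Finset.mem_coe.1 hd)
        exact hT hFT hdF
      refine ⟨a (T.biUnion id) m, ⟨haB _ _, hDf ⟨_, hB _ (haB _ _)⟩ E ?_⟩, fun x hx => ?_⟩
      · exact (subset_iUnion _ m).trans (hEc _ hF)
      · obtain ⟨F, hFT, rfl⟩ := Finset.mem_image.1 hx
        exact (ha _ m _ (Finset.mem_image_of_mem _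
          (Finset.mem_powerset.2 (Finset.subset_biUnion_of_mem id hFT)))).trans hm)
  refine ⟨s, fun n => (hs n).1, fun h hh hcl => ?_⟩
  have heq : ∀ x ∈ finsetPoint p '' {F | (F : Set (Σ i, X i)) ⊆ E}, h x = g x := fun x hx =>
    (hcl.continuousAt_comp (continuous_apply x).continuousAt).eq_of_tendsto (hsg x hx)
  -- Invariance under the retraction is a pointwise closed condition, so it passes to cluster
  -- points.
  have hret : ∀ x, h (coordRetract p E x) = h x := fun x =>
    (isClosed_eq (f := fun f : (∀ i, X i) → ℝ => f (coordRetract p E x)) (g := fun f => f x)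
      (continuous_apply _) (continuous_apply _)).mem_of_mapClusterPt hcl
      (Eventually.of_forall fun n => (hs n).2 x)
  funext x
  refine (hret x).symm.trans (Eq.trans ?_ (hDf ⟨g, hgc⟩ E hgE x))
  exact closure_minimal heq (isClosed_eq hh hgc) (coordRetract_mem_closure p E x)

/-- A countable product of almost discrete Lindelöf spaces is a Grothendieck space if it is
countably tight. -/
theorem isGrothendieckSpace_pi {ι : Type*} [Countable ι] {X : ι → Type*}
    [∀ i, TopologicalSpace (X i)] (p : ∀ i, X i)
    (hc : ∀ i, ∀ W ∈ 𝓝 (p i), (Wᶜ : Set (X i)).Countable)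
    (ht : ∀ (A : Set (∀ i, X i)), ∀ x ∈ closure A, ∃ B ⊆ A, B.Countable ∧ x ∈ closure B) :
    IsGrothendieckSpace (∀ i, X i) := by
  intro Y A hA
  let j : Y → (∀ i, X i) → ℝ := fun y => y.1.1
  have hj : IsInducing j := IsInducing.subtypeVal.comp IsInducing.subtypeVal
  have hjx : ∀ x, Continuous fun y => j y x := fun x => (continuous_apply x).comp hj.continuous
  have hbd : ∀ x, ∃ M : ℝ, ∀ y ∈ A, j y x ∈ Icc (-M) M := by
    intro x
    by_contra! hM
    choose s hsA hs using fun n : ℕ => hM n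
    obtain ⟨z, hz⟩ := hA s hsA
    obtain ⟨n, hn⟩ := exists_nat_gt (|j z x| + 1)
    have hnear : ∀ᶠ y in 𝓝 z, |j y x| < |j z x| + 1 :=
      (hjx x).abs.continuousAt.eventually (gt_mem_nhds (lt_add_one _))
    obtain ⟨k, hk, hnk⟩ := ((hz.frequently hnear).and_eventually (eventually_ge_atTop n)).exists
    refine hs k (abs_le.1 (hk.le.trans (hn.le.trans ?_)))
    exact_mod_cast hnk
  -- The closure in the full product `ℝ^X` adds nothing outside `Y`.
  have hmem : ∀ g ∈ closure (j '' A), ∃ y, j y = g := by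
    intro g hg
    have hgc : Continuous g := by
      refine continuous_of_eqOn_countable ht fun C hC => ?_
      obtain ⟨s, hs, hsg⟩ := exists_seq_tendsto_on_countable hC A j g fun K _ ε hε => by
        obtain ⟨_, ⟨y, hy, rfl⟩, h⟩ := exists_dist_lt_of_mem_closure hg K hε
        exact ⟨y, hy, h⟩
      obtain ⟨z, hz⟩ := hA s hs
      exact ⟨j z, z.1.2, fun x hx =>
        (hz.continuousAt_comp (hjx x).continuousAt).eq_of_tendsto (hsg x hx)⟩
    obtain ⟨s, hs, hsg⟩ := exists_seq_unique_mapClusterPt p hc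
      (by rintro _ ⟨y, -, rfl⟩; exact y.1.2) hg hgc
    choose t htA hts using hs
    obtain ⟨z, hz⟩ := hA t htA
    refine ⟨z, hsg _ z.1.2 ?_⟩
    have := hz.continuousAt_comp hj.continuous.continuousAt
    rwa [show j ∘ t = s from funext hts] at this
  rw [hj.isCompact_iff]
  choose M hM using hbd
  have himg : j '' closure A = closure (j '' A) := by
    refine (image_closure_subset_closure_image hj.continuous).antisymm fun g hg => ?_
    obtain ⟨y, rfl⟩ := hmem g hg
    exact ⟨y, by rwa [hj.closure_eq_preimage_closure_image], rfl⟩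
  rw [himg]
  refine (isCompact_univ_pi fun x => isCompact_Icc (a := -M x) (b := M x)).of_isClosed_subset
    isClosed_closure (closure_minimal ?_ (isClosed_set_pi fun _ _ => isClosed_Icc))
  rintro _ ⟨y, hy, rfl⟩ x -
  exact hM x y hy

theorem exists_countable_subset_image_eq {S T : Type*} {f : S → T} {A : Set S}
    (h : (f '' A).Countable) : ∃ B ⊆ A, B.Countable ∧ f '' B = f '' A := by
  obtain ⟨B, hBA, hB⟩ := (surjOn_image f A).exists_bijOn_subset
  exact ⟨B, hBA, hB.mapsTo.countable_of_injOn hB.injOn h, hB.image_eq⟩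

/-! ### A countably compact, noncompact family of indicators -/

section IndicatorFamily

variable {X : Type*} [TopologicalSpace X]

/-- The set of indicator functions of the preimages of the countable subsets of `𝒜`. -/
def countableIndicators {T : Type*} (φ : X → T) (𝒜 : Set T) : Set (Cp X) :=
  {f | ∃ B ⊆ 𝒜, B.Countable ∧ f.1 = (φ ⁻¹' B).indicator 1}

/-- If `φ` maps onto an uncountable set `𝒜` such that preimages of countable subsets of `𝒜` are
clopen, then the indicators of these preimages form a countably compact, noncompact subspace of
`C_p(X)`. -/
theorem not_isCCGrothendieckSpace_of_isClopen_preimage {T : Type*} (φ : X → T) {𝒜 : Set T}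
    (hφ : 𝒜 ⊆ range φ) (hunc : ¬ 𝒜.Countable)
    (hclopen : ∀ B ⊆ 𝒜, B.Countable → IsClopen (φ ⁻¹' B)) : ¬ IsCCGrothendieckSpace X := by
  classical
  intro hX
  have hcont : ∀ B ⊆ 𝒜, B.Countable → Continuous ((φ ⁻¹' B).indicator (1 : X → ℝ)) :=
    fun B hB hBc => continuous_one.indicator (by simp [(hclopen B hB hBc).frontier_eq])
  have hcc : IsCountablyCompact (univ : Set (countableIndicators φ 𝒜)) := by
    refine IsCountablyCompact.of_seq_clusterPt fun s _ => ?_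
    choose B hB hBc hs using fun n => (s n).2
    let 𝒰 : Ultrafilter ℕ := Ultrafilter.of atTop
    have h𝒰 : (𝒰 : Filter ℕ) ≤ atTop := Ultrafilter.of_le atTop
    -- The ultrafilter limit of the sets `B n` is countable, as it lies in their union.
    let L : Set T := {t | ∀ᶠ n in (𝒰 : Filter ℕ), t ∈ B n}
    have hL : L ⊆ ⋃ n, B n := fun t ht => by
      obtain ⟨n, hn⟩ := Eventually.exists (f := (𝒰 : Filter ℕ)) ht
      exact mem_iUnion.2 ⟨n, hn⟩
    have hL𝒜 : L ⊆ 𝒜 := hL.trans (iUnion_subset hB)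
    have hLc : L.Countable := (countable_iUnion hBc).mono hL
    refine ⟨⟨⟨_, hcont L hL𝒜 hLc⟩, L, hL𝒜, hLc, rfl⟩, mem_univ _, ?_⟩
    refine MapClusterPt.mono (F := (𝒰 : Filter ℕ)) (Tendsto.mapClusterPt ?_) h𝒰
    rw [tendsto_subtype_rng, tendsto_subtype_rng, tendsto_pi_nhds]
    intro x
    refine tendsto_const_nhds.congr' ?_
    by_cases hx : φ x ∈ L
    · have hx' : ∀ᶠ n in (𝒰 : Filter ℕ), φ x ∈ B n := hx
      filter_upwards [hx'] with n hn
      rw [hs n, indicator_of_mem (show x ∈ φ ⁻¹' L from hx),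
        indicator_of_mem (show x ∈ φ ⁻¹' B n from hn)]
    · have hx' : ∀ᶠ n in (𝒰 : Filter ℕ), φ x ∉ B n := Ultrafilter.eventually_not.2 hx
      filter_upwards [hx'] with n hn
      rw [hs n, indicator_of_notMem (show x ∉ φ ⁻¹' L from hx),
        indicator_of_notMem (show x ∉ φ ⁻¹' B n from hn)]
  have hcomp := hX (countableIndicators φ 𝒜) univ hcc
  rw [closure_univ] at hcomp
  let j : countableIndicators φ 𝒜 → X → ℝ := fun f => f.1.1
  have hj : Continuous j := continuous_subtype_val.comp continuous_subtype_val
  have hclosed : IsClosed (j '' univ) := (hcomp.image hj).isClosed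
  -- On finitely many points the indicator for `𝒜` agrees with that of a finite subset; a compact
  -- family would contain it, making `𝒜` countable.
  have hmem : (φ ⁻¹' 𝒜).indicator (1 : X → ℝ) ∈ closure (j '' univ) := by
    rw [mem_closure_iff]
    intro o ho hgo
    obtain ⟨I, u, hu, hI⟩ := isOpen_pi_iff.1 ho _ hgo
    have hsub : φ '' I ∩ 𝒜 ⊆ 𝒜 := inter_subset_right
    have hfin : (φ '' I ∩ 𝒜).Countable := (I.finite_toSet.image φ).countable.mono inter_subset_left
    refine ⟨_, hI fun x hx => ?_, ⟨⟨⟨_, hcont _ hsub hfin⟩, _, hsub, hfin, rfl⟩, trivial, rfl⟩⟩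
    have hux := (hu x hx).2
    by_cases hx𝒜 : φ x ∈ 𝒜
    · rw [indicator_of_mem (show x ∈ φ ⁻¹' 𝒜 from hx𝒜)] at hux
      simp only [j]
      rwa [indicator_of_mem (show x ∈ φ ⁻¹' (φ '' I ∩ 𝒜) from ⟨⟨x, hx, rfl⟩, hx𝒜⟩)]
    · rw [indicator_of_notMem (show x ∉ φ ⁻¹' 𝒜 from hx𝒜)] at hux
      simp only [j]
      rwa [indicator_of_notMem (show x ∉ φ ⁻¹' (φ '' I ∩ 𝒜) from fun h => hx𝒜 h.2)]
  rw [hclosed.closure_eq] at hmem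
  obtain ⟨⟨f, B, hB, hBc, hf⟩, -, hfg⟩ := hmem
  refine hunc (hBc.mono fun t ht => ?_)
  obtain ⟨x, rfl⟩ := hφ ht
  by_contra hx
  have h1 : f.1 x = 1 := by
    rw [show f.1 = _ from hfg]; exact indicator_of_mem (show x ∈ φ ⁻¹' 𝒜 from ht) 1
  have h0 : f.1 x = 0 := by
    rw [hf]; exact indicator_of_notMem (show x ∉ φ ⁻¹' B from hx) 1
  exact one_ne_zero (h1.symm.trans h0)

end IndicatorFamily

/-! ### Finite sets of coordinates and the necessity direction -/

section PartialClosure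

variable {ι : Type*} {X : ι → Type*} [∀ i, TopologicalSpace (X i)]

/-- The closure of `A` in the topology generated by the coordinates in `S`. -/
def coordClosure (S : Finset ι) (A : Set (∀ i, X i)) : Set (∀ i, X i) :=
  {x | ∀ W : ∀ i, Set (X i), (∀ i, IsOpen (W i)) → (∀ i ∈ S, x i ∈ W i) →
    ∃ a ∈ A, ∀ i ∈ S, a i ∈ W i}

variable {S : Finset ι} {A B : Set (∀ i, X i)} {x : ∀ i, X i}

theorem coordClosure_mono (h : A ⊆ B) : coordClosure S A ⊆ coordClosure S B :=
  fun _ hx W hW hxW => let ⟨a, ha, haW⟩ := hx W hW hxW; ⟨a, h ha, haW⟩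

theorem coordClosure_anti {S' : Finset ι} (h : S' ⊆ S) :
    coordClosure S A ⊆ coordClosure S' A := by
  classical
  intro x hx W hW hxW
  obtain ⟨a, ha, haW⟩ := hx (fun i => if i ∈ S' then W i else univ)
    (fun i => by split_ifs; exacts [hW i, isOpen_univ])
    (fun i _ => by split_ifs with hi; exacts [hxW i hi, trivial])
  refine ⟨a, ha, fun i hi => ?_⟩
  have := haW i (h hi)
  rwa [if_pos hi] at this

theorem coordClosure_subset_of_subset (h : A ⊆ coordClosure S B) :
    coordClosure S A ⊆ coordClosure S B := fun _ hx W hW hxW =>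
  let ⟨_, ha, haW⟩ := hx W hW hxW; h ha W hW haW

theorem mem_coordClosure_of_eqOn {y : ∀ i, X i} (hy : y ∈ A) (h : ∀ i ∈ S, y i = x i) :
    x ∈ coordClosure S A :=
  fun _ _ hxW => ⟨y, hy, fun i hi => by rw [h i hi]; exact hxW i hi⟩

theorem mem_coordClosure_congr {y : ∀ i, X i} (h : ∀ i ∈ S, x i = y i)
    (hx : x ∈ coordClosure S A) : y ∈ coordClosure S A :=
  coordClosure_subset_of_subset (singleton_subset_iff.2 hx)
    (mem_coordClosure_of_eqOn (mem_singleton x) h)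

theorem closure_subset_coordClosure (S : Finset ι) (A : Set (∀ i, X i)) :
    closure A ⊆ coordClosure S A := by
  intro x hx W hW hxW
  obtain ⟨a, haW, ha⟩ := mem_closure_iff.1 hx ((S : Set ι).pi W)
    (isOpen_set_pi S.finite_toSet fun i _ => hW i) hxW
  exact ⟨a, ha, haW⟩

theorem mem_closure_of_forall_mem_coordClosure (h : ∀ S, x ∈ coordClosure S A) :
    x ∈ closure A := by
  classical
  rw [mem_closure_iff]
  intro o ho hx
  obtain ⟨I, u, hu, hI⟩ := isOpen_pi_iff.1 ho _ hx
  obtain ⟨a, ha, haW⟩ := h I (fun i => if i ∈ I then u i else univ)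
    (fun i => by split_ifs with hi; exacts [(hu i hi).1, isOpen_univ])
    (fun i hi => by rw [if_pos hi]; exact (hu i hi).2)
  refine ⟨a, hI fun i hi => ?_, ha⟩
  have := haW i hi
  rwa [if_pos (Finset.mem_coe.1 hi)] at this

/-- Coordinates on which all of `A` agrees with `x` may be added to `S`. -/
theorem mem_coordClosure_of_erase [DecidableEq ι] {i : ι} (h : ∀ a ∈ A, a i = x i)
    (hx : x ∈ coordClosure (S.erase i) A) : x ∈ coordClosure S A := by
  intro W hW hxW
  obtain ⟨a, ha, haW⟩ := hx W hW fun k hk => hxW k (Finset.mem_of_mem_erase hk)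
  refine ⟨a, ha, fun k hk => ?_⟩
  by_cases hki : k = i
  · subst hki; rw [h a ha]; exact hxW k hk
  · exact haW k (Finset.mem_erase.2 ⟨hki, hk⟩)

/-- Points near a point with an isolated coordinate have the same coordinate. -/
theorem mem_coordClosure_of_isOpen_singleton [DecidableEq ι] {i : ι} (hi : i ∈ S)
    (ho : IsOpen ({x i} : Set (X i))) (hx : x ∈ coordClosure S A) :
    x ∈ coordClosure S {a ∈ A | a i = x i} := by
  intro W hW hxW
  obtain ⟨a, ha, haW⟩ := hx (fun k => {t ∈ W k | ∀ h : k = i, t = h ▸ x i})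
    (fun k => by
      by_cases hk : k = i
      · subst hk
        convert (hW k).inter ho using 1
        ext t
        simp
      · simpa [hk] using hW k)
    (fun k hk => ⟨hxW k hk, by rintro rfl; rfl⟩)
  exact ⟨a, ⟨ha, (haW i hi).2 rfl⟩, fun k hk => (haW k hk).1⟩

/-- Every point of the partial closure of a set is in the partial closure of a countable
subset. -/
def CoordTight (X : ι → Type*) [∀ i, TopologicalSpace (X i)] (S : Finset ι) : Prop :=
  ∀ (A : Set (∀ i, X i)), ∀ x ∈ coordClosure S A, ∃ B ⊆ A, B.Countable ∧ x ∈ coordClosure S B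

theorem CoordTight.exists_countable [DecidableEq ι] {i : ι} (h : CoordTight X (S.erase i))
    (hA : ∀ a ∈ A, a i = x i) (hx : x ∈ coordClosure S A) :
    ∃ B ⊆ A, B.Countable ∧ x ∈ coordClosure S B :=
  let ⟨B, hBA, hB, hxB⟩ := h A x (coordClosure_anti (Finset.erase_subset i S) hx)
  ⟨B, hBA, hB, mem_coordClosure_of_erase (fun a ha => hA a (hBA ha)) hxB⟩

/-- There are only countably many finite sets of coordinates, so the union of their countable
witnesses remains countable. -/
theorem exists_countable_mem_closure_of_coordTight [Countable ι] (h : ∀ S, CoordTight X S)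
    (hx : x ∈ closure A) : ∃ B ⊆ A, B.Countable ∧ x ∈ closure B := by
  choose B hBA hB hxB using fun S => h S A x (closure_subset_coordClosure S A hx)
  exact ⟨⋃ S, B S, iUnion_subset hBA, countable_iUnion hB,
    mem_closure_of_forall_mem_coordClosure fun S => coordClosure_mono (subset_iUnion B S) (hxB S)⟩

/-- If the partial closure for `S` fails to be countably tight, but those for the smaller sets
`S.erase i` are countably tight, then the product is not a Grothendieck space: some trace of `A`
on the coordinates in `S` consists of isolated points and accumulates only at `x`. -/
theorem not_isCCGrothendieckSpace_of_coordTight_erase [DecidableEq ι] (p : ∀ i, X i)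
    (hp : ∀ i, ∀ t ≠ p i, IsOpen ({t} : Set (X i)))
    (hS : ∀ i ∈ S, CoordTight X (S.erase i)) (hx : x ∈ coordClosure S A)
    (hne : ∀ B ⊆ A, B.Countable → x ∉ coordClosure S B) :
    ¬ IsCCGrothendieckSpace (∀ i, X i) := by
  have hiso : ∀ z ∈ coordClosure S A, ∀ i ∈ S, z i ≠ p i →
      ∃ B ⊆ A, B.Countable ∧ z ∈ coordClosure S B := by
    intro z hz i hi hzi
    obtain ⟨B, hBA, hB⟩ := (hS i hi).exists_countable (fun a ha => ha.2)
      (mem_coordClosure_of_isOpen_singleton hi (hp i _ hzi) hz)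
    exact ⟨B, hBA.trans (sep_subset _ _), hB⟩
  have hxp : ∀ i ∈ S, x i = p i := by
    intro i hi
    by_contra h
    obtain ⟨B, hBA, hB, hxB⟩ := hiso x hx i hi h
    exact hne B hBA hB hxB
  -- `x` avoids the partial closure of `E i`: otherwise tightness for `S.erase i` would pick
  -- countably many points of `E i`, and the union of their countable witnesses would accumulate at
  -- `x`.
  let E : ι → Set (∀ i, X i) := fun i =>
    {z | z i = p i ∧ ∃ B ⊆ A, B.Countable ∧ z ∈ coordClosure S B}
  have hE : ∀ i ∈ S, x ∉ coordClosure S (E i) := by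
    intro i hi hxE
    obtain ⟨E', hE', hE'c, hxE'⟩ := (hS i hi).exists_countable
      (fun a ha => ha.1.trans (hxp i hi).symm) hxE
    choose! B hBA hB hzB using fun z (hz : z ∈ E') => (hE' hz).2
    refine hne (⋃ z ∈ E', B z) (iUnion₂_subset hBA) (hE'c.biUnion hB) ?_
    exact coordClosure_subset_of_subset
      (fun z hz => coordClosure_mono (subset_biUnion_of_mem hz) (hzB z hz)) hxE'
  have hE' : ∀ i, ∃ W : ∀ k, Set (X k), (∀ k, IsOpen (W k)) ∧ (∀ k ∈ S, x k ∈ W k) ∧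
      (i ∈ S → ∀ z ∈ E i, ∃ k ∈ S, z k ∉ W k) := by
    intro i
    by_cases hi : i ∈ S
    · have := hE i hi
      simp only [coordClosure, mem_ofPred_eq] at this
      push Not at this
      obtain ⟨W, hW, hxW, h⟩ := this
      exact ⟨W, hW, hxW, fun _ => h⟩
    · exact ⟨fun _ => univ, fun _ => isOpen_univ, fun _ _ => trivial, fun h => absurd h hi⟩
  choose V hVo hxV hV using hE'
  let W : ∀ k, Set (X k) := fun k => ⋂ i ∈ S, V i k
  have hWo : ∀ k, IsOpen (W k) := fun k => isOpen_biInter_finset fun i _ => hVo i k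
  have hxW : ∀ k ∈ S, x k ∈ W k := fun k hk => mem_iInter₂.2 fun i _ => hxV i k hk
  have hWc : ∀ k ∈ S, IsClosed (W k) := by
    intro k hk
    rw [← isOpen_compl_iff, ← biUnion_of_singleton (W k)ᶜ]
    refine isOpen_biUnion fun t ht => hp k t ?_
    rintro rfl
    exact ht (hxp k hk ▸ hxW k hk)
  have hWE : ∀ z, (∀ k ∈ S, z k ∈ W k) → ∀ i ∈ S, z ∉ E i := by
    intro z hz i hi hzE
    obtain ⟨k, hk, hzk⟩ := hV i hi z hzE
    exact hzk (mem_iInter₂.1 (hz k hk) i hi)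
  let A' : Set (∀ i, X i) := {a ∈ A | ∀ k ∈ S, a k ∈ W k}
  have hA'A : A' ⊆ A := sep_subset _ _
  have hxA' : x ∈ coordClosure S A' := by
    intro U hU hxU
    obtain ⟨a, ha, haU⟩ := hx (fun k => U k ∩ W k) (fun k => (hU k).inter (hWo k))
      (fun k hk => ⟨hxU k hk, hxW k hk⟩)
    exact ⟨a, ⟨ha, fun k hk => (haU k hk).2⟩, fun k hk => (haU k hk).1⟩
  -- A point with an isolated and a nonisolated coordinate in `S` would lie in some `E i`, which `W`
  -- excludes.
  have hdich : ∀ z ∈ coordClosure S A, (∀ k ∈ S, z k ∈ W k) →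
      (∀ k ∈ S, z k = x k) ∨ ∀ k ∈ S, z k ≠ p k := by
    intro z hz hzW
    by_contra! hcon
    obtain ⟨⟨k, hk, hzk⟩, i, hi, hzi⟩ := hcon
    rw [hxp k hk] at hzk
    exact hWE z hzW i hi ⟨hzi, hiso z hz k hk hzk⟩
  have hA'iso : ∀ a ∈ A', ∀ k ∈ S, a k ≠ p k := by
    intro a ha
    refine (hdich a (mem_coordClosure_of_eqOn (hA'A ha) fun _ _ => rfl) ha.2).resolve_left ?_
    intro h
    exact hne {a} (singleton_subset_iff.2 (hA'A ha)) (countable_singleton a)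
      (mem_coordClosure_of_eqOn (mem_singleton a) h)
  have hrestr : ∀ {a b : ∀ i, X i}, S.restrict a = S.restrict b ↔ ∀ k ∈ S, a k = b k :=
    fun {a b} => ⟨fun h k hk => congrFun h ⟨k, hk⟩, fun h => funext fun k => h k k.2⟩
  refine not_isCCGrothendieckSpace_of_isClopen_preimage (S.restrict) (𝒜 := S.restrict '' A')
    (image_subset_range _ _) ?_ ?_
  · intro hcount
    obtain ⟨B, hBA', hB, hBimg⟩ := exists_countable_subset_image_eq hcount
    refine hne B (hBA'.trans hA'A) hB (coordClosure_subset_of_subset (fun a ha => ?_) hxA')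
    obtain ⟨b, hb, hba⟩ := hBimg.symm ▸ mem_image_of_mem S.restrict ha
    exact mem_coordClosure_of_eqOn hb (hrestr.1 hba)
  · intro R hR hRc
    obtain ⟨B, hBA', hB, hBR⟩ : ∃ B ⊆ A', B.Countable ∧ S.restrict '' B = R := by
      obtain ⟨Q, hQ, hQR⟩ := subset_image_iff.1 hR
      obtain ⟨B, hBQ, hB, h⟩ := exists_countable_subset_image_eq (hQR ▸ hRc)
      exact ⟨B, hBQ.trans hQ, hB, h.trans hQR⟩
    subst hBR
    have hopen : ∀ b : ∀ i, X i, (∀ k ∈ S, b k ≠ p k) → IsOpen {z : ∀ i, X i | ∀ k ∈ S, z k = b k} :=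
      fun b hb => isOpen_set_pi S.finite_toSet (s := fun k => {b k}) fun k hk => hp k _ (hb k hk)
    constructor
    -- A limit either agrees with `x` on `S`, impossible for a countable `B`, or has an isolated
    -- trace, which must then be that of a member of `B`.
    · refine isClosed_of_closure_subset fun z hz => ?_
      have hzB : z ∈ coordClosure S B := by
        refine coordClosure_subset_of_subset (fun y hy => ?_) (closure_subset_coordClosure S _ hz)
        obtain ⟨b, hb, hby⟩ := hy
        exact mem_coordClosure_of_eqOn hb (hrestr.1 hby)
      have hzW : ∀ k ∈ S, z k ∈ W k := by
        intro k hk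
        refine closure_minimal ?_ ((hWc k hk).preimage (continuous_apply k)) hz
        rintro y ⟨b, hb, hby⟩
        change y k ∈ W k
        rw [← hrestr.1 hby k hk]
        exact (hBA' hb).2 k hk
      rcases hdich z (coordClosure_mono (hBA'.trans hA'A) hzB) hzW with h | h
      · exact absurd (mem_coordClosure_congr h hzB) (hne B (hBA'.trans hA'A) hB)
      · obtain ⟨y, hyz, b, hb, hby⟩ := mem_closure_iff.1 hz _ (hopen z h) fun _ _ => rfl
        exact ⟨b, hb, hby.trans (hrestr.2 hyz)⟩
    · rw [isOpen_iff_mem_nhds]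
      rintro z ⟨b, hb, hbz⟩
      refine mem_of_superset ((hopen b (hA'iso b (hBA' hb))).mem_nhds
        fun k hk => (hrestr.1 hbz k hk).symm) fun y hy => ⟨b, hb, hrestr.2 fun k hk => (hy k hk).symm⟩

theorem IsCCGrothendieckSpace.coordTight_pi (hX : IsCCGrothendieckSpace (∀ i, X i)) (p : ∀ i, X i)
    (hp : ∀ i, ∀ t ≠ p i, IsOpen ({t} : Set (X i))) (S : Finset ι) : CoordTight X S := by
  classical
  induction S using Finset.strongInduction with
  | H S ih =>
    intro A x hx
    by_contra! hne
    exact not_isCCGrothendieckSpace_of_coordTight_erase p hp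
      (fun i hi => ih _ (Finset.erase_ssubset hi)) hx hne hX

/-- In a product of almost discrete spaces that is Grothendieck in the weak sense, the
neighbourhoods of the nonisolated points of the factors are cocountable. -/
theorem IsCCGrothendieckSpace.countable_compl_of_mem_nhds
    (hX : IsCCGrothendieckSpace (∀ i, X i)) (p : ∀ i, X i)
    (hp : ∀ i, ∀ t ≠ p i, IsOpen ({t} : Set (X i))) (i : ι) (W : Set (X i)) (hW : W ∈ 𝓝 (p i)) :
    (Wᶜ : Set (X i)).Countable := by
  classical
  by_contra hunc
  refine not_isCCGrothendieckSpace_of_isClopen_preimage (fun x : ∀ i, X i => x i) ?_ hunc ?_ hX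
  · exact fun t _ => ⟨Function.update p i t, Function.update_self i t p⟩
  · intro B hB _
    refine IsClopen.preimage ⟨?_, ?_⟩ (continuous_apply i)
    · rw [← isOpen_compl_iff, isOpen_iff_mem_nhds]
      intro t ht
      by_cases htp : t = p i
      · subst htp
        exact mem_of_superset hW fun s hs hsB => hB hsB hs
      · exact mem_of_superset ((hp i t htp).mem_nhds rfl) (singleton_subset_iff.2 ht)
    · rw [← biUnion_of_singleton B]
      refine isOpen_biUnion fun t ht => hp i t ?_
      rintro rfl
      exact hB ht (mem_of_mem_nhds hW)

end PartialClosure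

/-! ### Lindelöf factors, tightness and the final equivalences -/

theorem countable_compl_of_lindelofSpace {T : Type*} [TopologicalSpace T] [LindelofSpace T] {q : T}
    (hq : ∀ t ≠ q, IsOpen ({t} : Set T)) {W : Set T} (hW : W ∈ 𝓝 q) : (Wᶜ : Set T).Countable := by
  classical
  obtain ⟨C, hC, hCW⟩ := LindelofSpace.elim_nhds_subcover (fun t => if t = q then W else {t})
    fun t => by
      split_ifs with h
      · exact h ▸ hW
      · exact (hq t h).mem_nhds rfl
  refine hC.mono fun t ht => ?_
  obtain ⟨c, hc, htc⟩ := mem_iUnion₂.1 (hCW.symm ▸ mem_univ t :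
    t ∈ ⋃ x ∈ C, if x = q then W else {x})
  split_ifs at htc with h
  · exact absurd htc ht
  · rw [mem_singleton_iff.1 htc]; exact hc

theorem tightness_eq_aleph0_iff (T : Type*) [TopologicalSpace T] :
    tightness T = Cardinal.aleph0 ↔
      ∀ (A : Set T), ∀ x ∈ closure A, ∃ B ⊆ A, B.Countable ∧ x ∈ closure B := by
  constructor
  · intro h A x hx
    have hne : {τ : Cardinal | Cardinal.aleph0 ≤ τ ∧ ∀ (A : Set T), ∀ x ∈ closure A,
        ∃ B : Set T, B ⊆ A ∧ Cardinal.mk B ≤ τ ∧ x ∈ closure B}.Nonempty := by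
      -- The infimum of the empty set of cardinals is `0`, not `ℵ₀`.
      by_contra hemp
      rw [not_nonempty_iff_eq_empty] at hemp
      rw [tightness, hemp, Cardinal.sInf_empty] at h
      exact Cardinal.aleph0_ne_zero h.symm
    have hmem := csInf_mem hne
    rw [← tightness, h] at hmem
    obtain ⟨B, hBA, hB, hxB⟩ := hmem.2 A x hx
    exact ⟨B, hBA, Cardinal.le_aleph0_iff_set_countable.1 hB, hxB⟩
  · intro h
    have hmem : Cardinal.aleph0 ∈ {τ : Cardinal | Cardinal.aleph0 ≤ τ ∧ ∀ (A : Set T),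
        ∀ x ∈ closure A, ∃ B : Set T, B ⊆ A ∧ Cardinal.mk B ≤ τ ∧ x ∈ closure B} := by
      refine ⟨le_rfl, fun A x hx => ?_⟩
      obtain ⟨B, hBA, hB, hxB⟩ := h A x hx
      exact ⟨B, hBA, Cardinal.le_aleph0_iff_set_countable.2 hB, hxB⟩
    exact le_antisymm (csInf_le' hmem) (le_csInf ⟨_, hmem⟩ fun τ hτ => hτ.1)

theorem IsCountablyCompact.isCountablyCompactIn {Z : Type*} [TopologicalSpace Z] {A : Set Z}
    (hA : IsCountablyCompact A) : IsCountablyCompactIn A := fun s hs =>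
  let ⟨z, _, hz⟩ := hA.seq_clusterPt s (Eventually.of_forall hs); ⟨z, hz⟩

theorem IsGrothendieckSpace.isCCGrothendieckSpace {X : Type*} [TopologicalSpace X]
    (h : IsGrothendieckSpace X) : IsCCGrothendieckSpace X :=
  fun Y A hA => h Y A hA.isCountablyCompactIn

theorem theorem3p6 {ι : Type*} [Countable ι] (X : ι → Type*)
    [∀ i, TopologicalSpace (X i)] [∀ i, T35Space (X i)]
    (hX : ∀ i, IsAlmostDiscrete (X i)) :
    (IsGrothendieckSpace (∀ i, X i) ↔
      tightness (∀ i, X i) = Cardinal.aleph0 ∧ LindelofSpace (∀ i, X i)) ∧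
    (IsCCGrothendieckSpace (∀ i, X i) ↔
      tightness (∀ i, X i) = Cardinal.aleph0 ∧ LindelofSpace (∀ i, X i)) := by
  choose p _ hpu using hX
  have hp : ∀ i, ∀ t ≠ p i, IsOpen ({t} : Set (X i)) := fun i t ht => by
    by_contra h
    exact ht (hpu i t h)
  have hback : tightness (∀ i, X i) = Cardinal.aleph0 ∧ LindelofSpace (∀ i, X i) →
      IsGrothendieckSpace (∀ i, X i) := by
    classical
    rintro ⟨ht, hL⟩
    refine isGrothendieckSpace_pi p (fun i W hW => ?_) ((tightness_eq_aleph0_iff _).1 ht)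
    have : LindelofSpace (X i) := LindelofSpace.of_continuous_surjective (continuous_apply i)
      fun t => ⟨Function.update p i t, Function.update_self i t p⟩
    exact countable_compl_of_lindelofSpace (hp i) hW
  have hforw : IsCCGrothendieckSpace (∀ i, X i) →
      tightness (∀ i, X i) = Cardinal.aleph0 ∧ LindelofSpace (∀ i, X i) := fun h =>
    ⟨(tightness_eq_aleph0_iff _).2 fun A x hx =>
      exists_countable_mem_closure_of_coordTight (h.coordTight_pi p hp) hx,
      lindelofSpace_pi_of_cocountable_nhds p (h.countable_compl_of_mem_nhds p hp)⟩
  exact ⟨⟨fun h => hforw h.isCCGrothendieckSpace, hback⟩,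
    ⟨hforw, fun h => (hback h).isCCGrothendieckSpace⟩⟩
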